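/- For a field $K \subseteq \mathbb{C}$ and a binary form $f \in K[x,y]$ of degree $d$, let $L_K(f)$ denote the smallest $r$ for which there is a representation $f(x,y) = \sum_{j=1}^r \lambda_j(\alpha_j x + \beta_j y)^d$ with $\lambda_j, \alpha_j, \beta_j \in K$. Let $s(K)$ denote the smallest $n$ such that $-1$ is a sum of $n$ squares in $K$, with $s(K) = \infty$ if $-1$ is not a sum of squares in $K$. Let $f(x,y) = \binom{6}{1}x^5y - \binom{6}{3}x^3y^3 = 6x^5y - 20x^3y^3$. Then for every field $K \subseteq \mathbb{C}$, $L_K(f) = 4$ if and only if $s(K) \le 2$. In particular, if $m$ is a positive square-free integer with $m \not\equiv 7 \pmod 8$, then $L_{\mathbb{Q}(\sqrt{-m})}(f) = 4$. Further, $L_{\mathbb{Q}(\sqrt{-7})}(f) = 5$. -/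

import Mathlib

open MvPolynomial

/-- `f` is a sum of `r` terms `c (a x + b y) ^ d` with all `c, a, b` in the subfield `K` of `ℂ`.
Here `x = X 0` and `y = X 1`. -/
def HasPowerSumRep (K : Subfield ℂ) (d : ℕ) (f : MvPolynomial (Fin 2) ℂ) (r : ℕ) : Prop :=
  ∃ c a b : Fin r → K,
    f = ∑ j, C (c j : ℂ) * (C (a j : ℂ) * X 0 + C (b j : ℂ) * X 1) ^ d

/-- The `K`-length (`K`-rank) of a binary form `f` of degree `d`: the smallest number of terms in
a representation of `f` as a `K`-linear combination of `d`-th powers of linear forms over `K`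
(`⊤` if there is no representation). -/
noncomputable def kLength (K : Subfield ℂ) (d : ℕ) (f : MvPolynomial (Fin 2) ℂ) : ℕ∞ :=
  ⨅ (r : ℕ) (_ : HasPowerSumRep K d f r), (r : ℕ∞)

/-- The Stufe of a field: the smallest `n` such that `-1` is a sum of `n` squares
(`⊤` if `-1` is not a sum of squares, i.e. if the field is formally real). -/
noncomputable def stufe (F : Type*) [Field F] : ℕ∞ :=
  ⨅ (n : ℕ) (_ : ∃ a : Fin n → F, ∑ i, a i ^ 2 = -1), (n : ℕ∞)

/-- The subfield `ℚ(√-m)` of `ℂ`. -/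
noncomputable def imagQuadraticField (m : ℕ) : Subfield ℂ :=
  (IntermediateField.adjoin ℚ {((Real.sqrt m : ℝ) : ℂ) * Complex.I}).toSubfield

/-! Sylvester's apolarity method. If `f = ∑ c_j (a_j x + b_j y)^6`, the normalised coefficients of
`f` are the moments `M_k = ∑ c_j a_j^k b_j^(6-k)`, and `∏ (b_j T - a_j S)` vanishes at every node
`(a_j, b_j)`. Its coefficients therefore give a linear recurrence on the `M_k`, here `M_3 = -1`,
`M_5 = 1` and otherwise 0. With three terms the recurrence kills the whole product, which is
impossible. With four it forces the product to be a multiple of `T^4 + T^2 S^2 + e S^4`; since this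
splits over `K`, its roots are `±s, ±t` with `s^2 + t^2 = -1`. Conversely such roots, once distinct
and nonzero, carry a representation.

Over `ℚ(√-m)`, `-1` is a sum of two squares once `m z^2` is a sum of three integer squares with `z ≠
0`. For `m` not 7 mod 8 this follows from Dirichlet's theorem, quadratic reciprocity and a case of
Legendre's theorem. For `m = 7` two squares summing to `-1` would make 7 a sum of three rational
squares, and an explicit five-term representation gives the upper bound. -/

/-! ### Lengths and Stufe as infima of upward closed conditions -/

theorem iInf_natCast_le_iff {P : ℕ → Prop} (hP : ∀ n, P n → P (n + 1)) (N : ℕ) :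
    (⨅ (n : ℕ) (_ : P n), (n : ℕ∞)) ≤ N ↔ P N := by
  refine ⟨fun h => ?_, fun h => iInf₂_le N h⟩
  by_contra hN
  have h1 : ((N + 1 : ℕ) : ℕ∞) ≤ ⨅ (n : ℕ) (_ : P n), (n : ℕ∞) := by
    refine le_iInf₂ fun n hn => ?_
    rw [Nat.cast_le]
    by_contra hlt
    exact hN (Nat.le_induction hn (fun k _ hk => hP k hk) N (by omega))
  have h2 := h1.trans h
  rw [Nat.cast_le] at h2
  omega

theorem iInf_natCast_eq_succ_iff {P : ℕ → Prop} (hP : ∀ n, P n → P (n + 1)) (N : ℕ) :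
    (⨅ (n : ℕ) (_ : P n), (n : ℕ∞)) = (N + 1 : ℕ) ↔ P (N + 1) ∧ ¬ P N := by
  rw [← iInf_natCast_le_iff hP N, ← iInf_natCast_le_iff hP (N + 1)]
  constructor
  · intro h
    rw [h]
    simp only [Nat.cast_le]
    omega
  · rintro ⟨h1, h2⟩
    refine le_antisymm h1 ?_
    rw [not_le] at h2
    simpa using Order.add_one_le_of_lt h2

theorem HasPowerSumRep.succ {K : Subfield ℂ} {d : ℕ} {f : MvPolynomial (Fin 2) ℂ} (r : ℕ)
    (h : HasPowerSumRep K d f r) : HasPowerSumRep K d f (r + 1) := by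
  obtain ⟨c, a, b, h⟩ := h
  refine ⟨Fin.cons 0 c, Fin.cons 0 a, Fin.cons 0 b, ?_⟩
  simp [Fin.sum_univ_succ, h]

theorem kLength_eq_succ_iff {K : Subfield ℂ} {d : ℕ} {f : MvPolynomial (Fin 2) ℂ} (r : ℕ) :
    kLength K d f = (r + 1 : ℕ) ↔ HasPowerSumRep K d f (r + 1) ∧ ¬ HasPowerSumRep K d f r :=
  iInf_natCast_eq_succ_iff HasPowerSumRep.succ r

theorem stufe_le_two_iff {F : Type*} [Field F] :
    stufe F ≤ 2 ↔ ∃ s t : F, s ^ 2 + t ^ 2 = -1 := by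
  have h := iInf_natCast_le_iff (P := fun n => ∃ a : Fin n → F, ∑ i, a i ^ 2 = -1)
    (fun n ⟨a, ha⟩ => ⟨Fin.cons 0 a, by simp [Fin.sum_univ_succ, ha]⟩) 2
  refine Iff.trans h ⟨fun ⟨a, ha⟩ => ⟨a 0, a 1, ?_⟩, fun ⟨s, t, hst⟩ => ⟨![s, t], ?_⟩⟩
  · simpa [Fin.sum_univ_two] using ha
  · simpa [Fin.sum_univ_two] using hst

/-! ### Representations of the sextic as moment conditions -/

/-- The binary sextic `6 x⁵ y - 20 x³ y³`. -/
noncomputable def sextic : MvPolynomial (Fin 2) ℂ := 6 * X 0 ^ 5 * X 1 - 20 * X 0 ^ 3 * X 1 ^ 3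

theorem coeff_linear_pow_six (c a b : ℂ) (k : ℕ) (hk : k ≤ 6) :
    (Polynomial.C c * (Polynomial.C a * Polynomial.X + Polynomial.C b) ^ 6).coeff k =
      (Nat.choose 6 k : ℂ) * (c * a ^ k * b ^ (6 - k)) := by
  have h : Polynomial.C c * (Polynomial.C a * Polynomial.X + Polynomial.C b) ^ 6 =
      ∑ m ∈ Finset.range 7,
        Polynomial.C ((Nat.choose 6 m : ℂ) * (c * a ^ m * b ^ (6 - m))) * Polynomial.X ^ m := by
    rw [add_pow, Finset.mul_sum]
    refine Finset.sum_congr rfl fun m _ => ?_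
    simp only [map_mul, map_pow, map_natCast]
    ring
  rw [h, Polynomial.finsetSum_coeff]
  simp only [Polynomial.coeff_C_mul_X_pow]
  rw [Finset.sum_ite_eq, if_pos (Finset.mem_range.2 (by omega))]

/-- The normalised coefficient of `x ^ k y ^ (6 - k)` in `sextic`. -/
def sexticMoment (k : ℕ) : ℤ := if k = 5 then 1 else if k = 3 then -1 else 0

theorem moments_of_rep {K : Subfield ℂ} {r : ℕ} {c a b : Fin r → K}
    (h : sextic = ∑ j, C (c j : ℂ) * (C (a j : ℂ) * X 0 + C (b j : ℂ) * X 1) ^ 6)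
    (k : ℕ) (hk : k ≤ 6) :
    ∑ j, c j * a j ^ k * b j ^ (6 - k) = (sexticMoment k : K) := by
  have h1 := congrArg (MvPolynomial.aeval ![Polynomial.X, (1 : Polynomial ℂ)]) h
  simp only [sextic, map_sum, map_mul, map_add, map_sub, map_pow, MvPolynomial.aeval_X,
    MvPolynomial.aeval_C, map_ofNat, Matrix.cons_val_zero, Matrix.cons_val_one, mul_one, one_pow,
    Polynomial.algebraMap_eq] at h1
  have h2 := congrArg (fun p => Polynomial.coeff p k) h1
  simp only [Polynomial.finsetSum_coeff] at h2
  rw [Finset.sum_congr rfl (fun j _ => coeff_linear_pow_six _ _ _ k hk), ← Finset.mul_sum] at h2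
  apply Subtype.val_injective
  push_cast
  have h3 : (6 * (Polynomial.X : Polynomial ℂ) ^ 5 - 20 * Polynomial.X ^ 3).coeff k =
      (Nat.choose 6 k : ℂ) * (sexticMoment k : ℂ) := by
    have e6 : (6 : Polynomial ℂ) = Polynomial.C 6 := rfl
    have e20 : (20 : Polynomial ℂ) = Polynomial.C 20 := rfl
    rw [e6, e20, Polynomial.coeff_sub, Polynomial.coeff_C_mul_X_pow,
      Polynomial.coeff_C_mul_X_pow]
    interval_cases k <;> simp [sexticMoment, Nat.choose]
  rw [h3] at h2
  have h4 : (Nat.choose 6 k : ℂ) ≠ 0 := by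
    exact_mod_cast (Nat.choose_pos hk).ne'
  exact (mul_left_cancel₀ h4 h2).symm

theorem rep_of_moments {K : Subfield ℂ} {r : ℕ} {c a b : Fin r → K}
    (h : ∀ k ≤ 6, ∑ j, c j * a j ^ k * b j ^ (6 - k) = (sexticMoment k : K)) :
    HasPowerSumRep K 6 sextic r := by
  refine ⟨c, a, b, ?_⟩
  have h1 : ∑ j, C (c j : ℂ) * (C (a j : ℂ) * X 0 + C (b j : ℂ) * X 1) ^ 6 =
      ∑ k ∈ Finset.range 7, C ((∑ j, c j * a j ^ k * b j ^ (6 - k) : K) : ℂ) *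
        ((X 0 : MvPolynomial (Fin 2) ℂ) ^ k * X 1 ^ (6 - k) * ((Nat.choose 6 k : ℕ) : MvPolynomial (Fin 2) ℂ)) := by
    simp only [add_pow, Finset.mul_sum, AddSubmonoidClass.coe_finsetSum, map_sum, Finset.sum_mul]
    rw [Finset.sum_comm]
    refine Finset.sum_congr rfl fun k _ => Finset.sum_congr rfl fun j _ => ?_
    push_cast
    simp only [map_mul, map_pow]
    ring
  rw [h1, Finset.sum_congr rfl fun k hk => by
    rw [h k (Nat.lt_succ_iff.1 (Finset.mem_range.1 hk))]]
  simp only [Finset.sum_range_succ, Finset.sum_range_zero, sexticMoment, Nat.choose, sextic]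
  norm_num
  ring

/-- A zero linear form is traded for `x` with coefficient 0, so that the product of the linear forms
attached to the nodes is nonzero. -/
theorem HasPowerSumRep.exists_moments {K : Subfield ℂ} {r : ℕ}
    (h : HasPowerSumRep K 6 sextic r) :
    ∃ c a b : Fin r → K, (∀ j, a j ≠ 0 ∨ b j ≠ 0) ∧
      ∀ k ≤ 6, ∑ j, c j * a j ^ k * b j ^ (6 - k) = (sexticMoment k : K) := by
  classical
  obtain ⟨c, a, b, h⟩ := h
  refine ⟨fun j => if a j = 0 ∧ b j = 0 then 0 else c j,
    fun j => if a j = 0 ∧ b j = 0 then 1 else a j, b, fun j => ?_, moments_of_rep ?_⟩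
  · by_cases hj : a j = 0 ∧ b j = 0
    · simp [hj]
    · simp only [hj, if_false]
      tauto
  · rw [h]
    refine Finset.sum_congr rfl fun j _ => ?_
    by_cases hj : a j = 0 ∧ b j = 0 <;> simp [hj]

/-! ### Apolarity: obstructions to three and four terms -/

/-- `H0` to `H3` are the four recurrence relations. They annihilate every coefficient of `∏ (b_j T -
a_j S)`, a product of nonzero linear forms. -/
theorem not_hasPowerSumRep_three (K : Subfield ℂ) : ¬ HasPowerSumRep K 6 sextic 3 := by
  intro h
  obtain ⟨c, a, b, hne, hm⟩ := h.exists_moments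
  have e0 := hm 0 (by norm_num)
  have e1 := hm 1 (by norm_num)
  have e2 := hm 2 (by norm_num)
  have e3 := hm 3 (by norm_num)
  have e4 := hm 4 (by norm_num)
  have e5 := hm 5 (by norm_num)
  have e6 := hm 6 (by norm_num)
  simp [Fin.sum_univ_three, sexticMoment] at e0 e1 e2 e3 e4 e5 e6
  have n0 := hne 0
  have n1 := hne 1
  have n2 := hne 2
  generalize a 0 = a₀, a 1 = a₁, a 2 = a₂, b 0 = b₀, b 1 = b₁, b 2 = b₂,
    c 0 = c₀, c 1 = c₁, c 2 = c₂ at *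
  have H0 : b₀ * b₁ * b₂ = 0 := by
    linear_combination (b₀ * b₁ * b₂) * e3 - (a₀ * b₁ * b₂ + b₀ * a₁ * b₂ + b₀ * b₁ * a₂) * e2
      + (a₀ * a₁ * b₂ + a₀ * b₁ * a₂ + b₀ * a₁ * a₂) * e1 - (a₀ * a₁ * a₂) * e0
  have H1 : a₀ * b₁ * b₂ + b₀ * a₁ * b₂ + b₀ * b₁ * a₂ = 0 := by
    linear_combination -(b₀ * b₁ * b₂) * e4 + (a₀ * b₁ * b₂ + b₀ * a₁ * b₂ + b₀ * b₁ * a₂) * e3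
      - (a₀ * a₁ * b₂ + a₀ * b₁ * a₂ + b₀ * a₁ * a₂) * e2 + (a₀ * a₁ * a₂) * e1
  have H2 : a₀ * a₁ * b₂ + a₀ * b₁ * a₂ + b₀ * a₁ * a₂ = 0 := by
    linear_combination H0 + (b₀ * b₁ * b₂) * e5
      - (a₀ * b₁ * b₂ + b₀ * a₁ * b₂ + b₀ * b₁ * a₂) * e4
      + (a₀ * a₁ * b₂ + a₀ * b₁ * a₂ + b₀ * a₁ * a₂) * e3 - (a₀ * a₁ * a₂) * e2
  have H3 : a₀ * a₁ * a₂ = 0 := by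
    linear_combination H1 - (b₀ * b₁ * b₂) * e6
      + (a₀ * b₁ * b₂ + b₀ * a₁ * b₂ + b₀ * b₁ * a₂) * e5
      - (a₀ * a₁ * b₂ + a₀ * b₁ * a₂ + b₀ * a₁ * a₂) * e4 + (a₀ * a₁ * a₂) * e3
  clear e0 e1 e2 e3 e4 e5 e6 hm hne
  grind

/-- Four elements with elementary symmetric functions `e₁ = e₃ = 0` and `e₂ = 1` come in two
opposite pairs, so that `-1` is a sum of two squares. -/
theorem exists_sq_add_sq_of_symm {F : Type*} [Field F] {p q r s : F} (h1 : p + q + r + s = 0)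
    (h2 : p * q + p * r + p * s + q * r + q * s + r * s = 1)
    (h3 : p * q * r + p * q * s + p * r * s + q * r * s = 0) :
    ∃ x y : F, x ^ 2 + y ^ 2 = -1 := by
  obtain rfl : s = -(p + q + r) := by linear_combination h1
  have h : (p + q) * ((p + r) * (q + r)) = 0 := by linear_combination -h3
  rcases mul_eq_zero.1 h with h | h
  · exact ⟨p, r, by linear_combination -h2 - (q + r) * h⟩
  · rcases mul_eq_zero.1 h with h | h
    · exact ⟨p, q, by linear_combination -h2 - (q + r) * h⟩
    · exact ⟨p, q, by linear_combination -h2 - (p + r) * h⟩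

/-- The hypotheses say that `∏ (b_j T - a_j S)` is a multiple of `S^3`; by unique factorization each
factor is a multiple of `S`. -/
theorem eq_zero_of_symm_three {F : Type*} [Field F] {a₁ a₂ a₃ b₁ b₂ b₃ : F}
    (n1 : a₁ ≠ 0 ∨ b₁ ≠ 0) (n2 : a₂ ≠ 0 ∨ b₂ ≠ 0) (n3 : a₃ ≠ 0 ∨ b₃ ≠ 0)
    (h0 : b₁ * b₂ * b₃ = 0) (h1 : a₁ * b₂ * b₃ + b₁ * a₂ * b₃ + b₁ * b₂ * a₃ = 0)
    (h2 : a₁ * a₂ * b₃ + a₁ * b₂ * a₃ + b₁ * a₂ * a₃ = 0) : b₁ = 0 ∧ b₂ = 0 ∧ b₃ = 0 := by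
  grind

theorem eq_zero_of_symm_four {F : Type*} [Field F] {a₀ a₁ a₂ a₃ b₀ b₁ b₂ b₃ : F}
    (hb : b₀ = 0) (n0 : a₀ ≠ 0 ∨ b₀ ≠ 0)
    (n1 : a₁ ≠ 0 ∨ b₁ ≠ 0) (n2 : a₂ ≠ 0 ∨ b₂ ≠ 0) (n3 : a₃ ≠ 0 ∨ b₃ ≠ 0)
    (h1 : a₀ * b₁ * b₂ * b₃ + b₀ * a₁ * b₂ * b₃ + b₀ * b₁ * a₂ * b₃ + b₀ * b₁ * b₂ * a₃ = 0)
    (h2 : a₀ * a₁ * b₂ * b₃ + a₀ * b₁ * a₂ * b₃ + a₀ * b₁ * b₂ * a₃ + b₀ * a₁ * a₂ * b₃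
        + b₀ * a₁ * b₂ * a₃ + b₀ * b₁ * a₂ * a₃ - b₀ * b₁ * b₂ * b₃ = 0)
    (h3 : a₀ * a₁ * a₂ * b₃ + a₀ * a₁ * b₂ * a₃ + a₀ * b₁ * a₂ * a₃ + b₀ * a₁ * a₂ * a₃ = 0) :
    b₁ = 0 ∧ b₂ = 0 ∧ b₃ = 0 := by
  subst hb
  have ha : a₀ ≠ 0 := by simpa using n0
  apply eq_zero_of_symm_three n1 n2 n3 <;> apply mul_left_cancel₀ ha
  · linear_combination h1
  · linear_combination h2
  · linear_combination h3

theorem exists_sq_add_sq_of_rep_four {K : Subfield ℂ} (h : HasPowerSumRep K 6 sextic 4) :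
    ∃ s t : K, s ^ 2 + t ^ 2 = -1 := by
  obtain ⟨c, a, b, hne, hm⟩ := h.exists_moments
  have e0 := hm 0 (by norm_num)
  have e1 := hm 1 (by norm_num)
  have e2 := hm 2 (by norm_num)
  have e3 := hm 3 (by norm_num)
  have e4 := hm 4 (by norm_num)
  have e5 := hm 5 (by norm_num)
  have e6 := hm 6 (by norm_num)
  simp [Fin.sum_univ_four, sexticMoment] at e0 e1 e2 e3 e4 e5 e6
  have n0 := hne 0
  have n1 := hne 1
  have n2 := hne 2
  have n3 := hne 3
  generalize a 0 = a₀, a 1 = a₁, a 2 = a₂, a 3 = a₃, b 0 = b₀, b 1 = b₁, b 2 = b₂, b 3 = b₃,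
    c 0 = c₀, c 1 = c₁, c 2 = c₂, c 3 = c₃ at *
  have H1 : a₀ * b₁ * b₂ * b₃ + b₀ * a₁ * b₂ * b₃ + b₀ * b₁ * a₂ * b₃ + b₀ * b₁ * b₂ * a₃ = 0 := by
    linear_combination -(b₀ * b₁ * b₂ * b₃) * e4
      + (a₀ * b₁ * b₂ * b₃ + b₀ * a₁ * b₂ * b₃ + b₀ * b₁ * a₂ * b₃ + b₀ * b₁ * b₂ * a₃) * e3
      - (a₀ * a₁ * b₂ * b₃ + a₀ * b₁ * a₂ * b₃ + a₀ * b₁ * b₂ * a₃ + b₀ * a₁ * a₂ * b₃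
        + b₀ * a₁ * b₂ * a₃ + b₀ * b₁ * a₂ * a₃) * e2
      + (a₀ * a₁ * a₂ * b₃ + a₀ * a₁ * b₂ * a₃ + a₀ * b₁ * a₂ * a₃ + b₀ * a₁ * a₂ * a₃) * e1
      - (a₀ * a₁ * a₂ * a₃) * e0
  have H2 : a₀ * a₁ * b₂ * b₃ + a₀ * b₁ * a₂ * b₃ + a₀ * b₁ * b₂ * a₃ + b₀ * a₁ * a₂ * b₃
        + b₀ * a₁ * b₂ * a₃ + b₀ * b₁ * a₂ * a₃
      - b₀ * b₁ * b₂ * b₃ = 0 := by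
    linear_combination (b₀ * b₁ * b₂ * b₃) * e5
      - (a₀ * b₁ * b₂ * b₃ + b₀ * a₁ * b₂ * b₃ + b₀ * b₁ * a₂ * b₃ + b₀ * b₁ * b₂ * a₃) * e4
      + (a₀ * a₁ * b₂ * b₃ + a₀ * b₁ * a₂ * b₃ + a₀ * b₁ * b₂ * a₃ + b₀ * a₁ * a₂ * b₃
        + b₀ * a₁ * b₂ * a₃ + b₀ * b₁ * a₂ * a₃) * e3
      - (a₀ * a₁ * a₂ * b₃ + a₀ * a₁ * b₂ * a₃ + a₀ * b₁ * a₂ * a₃ + b₀ * a₁ * a₂ * a₃) * e2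
      + (a₀ * a₁ * a₂ * a₃) * e1
  have H3 : a₀ * a₁ * a₂ * b₃ + a₀ * a₁ * b₂ * a₃ + a₀ * b₁ * a₂ * a₃ + b₀ * a₁ * a₂ * a₃ = 0 := by
    linear_combination H1 - (b₀ * b₁ * b₂ * b₃) * e6
      + (a₀ * b₁ * b₂ * b₃ + b₀ * a₁ * b₂ * b₃ + b₀ * b₁ * a₂ * b₃ + b₀ * b₁ * b₂ * a₃) * e5
      - (a₀ * a₁ * b₂ * b₃ + a₀ * b₁ * a₂ * b₃ + a₀ * b₁ * b₂ * a₃ + b₀ * a₁ * a₂ * b₃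
        + b₀ * a₁ * b₂ * a₃ + b₀ * b₁ * a₂ * a₃) * e4
      + (a₀ * a₁ * a₂ * b₃ + a₀ * a₁ * b₂ * a₃ + a₀ * b₁ * a₂ * a₃ + b₀ * a₁ * a₂ * a₃) * e3
      - (a₀ * a₁ * a₂ * a₃) * e2
  -- If one node were at infinity, the relations would put all four there, making the fifth moment 0
  -- instead of 1.
  have H0 : b₀ * b₁ * b₂ * b₃ ≠ 0 := by
    intro H0
    have hb : b₀ = 0 ∧ b₁ = 0 ∧ b₂ = 0 ∧ b₃ = 0 := by
      simp only [mul_eq_zero] at H0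
      rcases H0 with ((h | h) | h) | h
      · exact ⟨h, eq_zero_of_symm_four h n0 n1 n2 n3 H1 H2 H3⟩
      · have := eq_zero_of_symm_four h n1 n0 n2 n3 (by linear_combination H1)
          (by linear_combination H2) (by linear_combination H3)
        tauto
      · have := eq_zero_of_symm_four h n2 n0 n1 n3 (by linear_combination H1)
          (by linear_combination H2) (by linear_combination H3)
        tauto
      · have := eq_zero_of_symm_four h n3 n0 n1 n2 (by linear_combination H1)
          (by linear_combination H2) (by linear_combination H3)
        tauto
    simp [hb] at e5
  clear e0 e1 e2 e3 e4 e5 e6 hm hne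
  have hb : b₀ ≠ 0 ∧ b₁ ≠ 0 ∧ b₂ ≠ 0 ∧ b₃ ≠ 0 := by simpa [and_assoc] using H0
  obtain ⟨hb0, hb1, hb2, hb3⟩ := hb
  apply exists_sq_add_sq_of_symm (p := a₀ / b₀) (q := a₁ / b₁) (r := a₂ / b₂) (s := a₃ / b₃)
  · field_simp
    linear_combination H1
  · field_simp
    linear_combination H2
  · field_simp
    linear_combination H3

/-! ### Four-term representations from `s^2 + t^2 = -1` -/

/-- The nodes are `±s, ±t`. Opposite weights on opposite nodes kill the even moments; `u s = v t =
l` kills the first, and `l` is scaled to make the third `-1`. The fifth is then `-(s^2 + t^2) = 1`.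
-/
theorem hasPowerSumRep_four {K : Subfield ℂ} {s t : K} (h : s ^ 2 + t ^ 2 = -1) (hs : s ≠ 0)
    (ht : t ≠ 0) (hst : s ^ 2 - t ^ 2 ≠ 0) : HasPowerSumRep K 6 sextic 4 := by
  obtain ⟨l, hl⟩ : ∃ l : K, l * (2 * (s ^ 2 - t ^ 2)) = -1 :=
    ⟨-1 / (2 * (s ^ 2 - t ^ 2)), by field_simp⟩
  obtain ⟨u, hu⟩ : ∃ u : K, u = l / s := ⟨_, rfl⟩
  obtain ⟨v, hv⟩ : ∃ v : K, v = l / t := ⟨_, rfl⟩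
  have hus : u * s = l := by rw [hu]; field_simp
  have hvt : v * t = l := by rw [hv]; field_simp
  have c1 : u * s - v * t = 0 := by rw [hus, hvt, sub_self]
  have c3 : 2 * (u * s ^ 3 - v * t ^ 3) = -1 := by
    linear_combination hl + 2 * s ^ 2 * hus - 2 * t ^ 2 * hvt
  have c5 : 2 * (u * s ^ 5 - v * t ^ 5) = 1 := by
    linear_combination (s ^ 2 + t ^ 2) * hl - h + 2 * s ^ 4 * hus - 2 * t ^ 4 * hvt
  refine rep_of_moments (c := ![u, -u, -v, v]) (a := ![s, -s, t, -t]) (b := ![1, 1, 1, 1])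
    fun k hk => ?_
  simp only [Fin.sum_univ_four, Matrix.cons_val]
  interval_cases k <;> simp [sexticMoment]
  · linear_combination 2 * c1
  · linear_combination c3
  · ring
  · linear_combination c5
  · ring

/-- If `-1` is a sum of two squares, it is so in a generic way. -/
theorem exists_generic_sq_add_sq {F : Type*} [Field F] [CharZero F] {s t : F}
    (h : s ^ 2 + t ^ 2 = -1) :
    ∃ s t : F, s ^ 2 + t ^ 2 = -1 ∧ s ≠ 0 ∧ t ≠ 0 ∧ s ^ 2 - t ^ 2 ≠ 0 := by
  have h5 : (5 : F) ≠ 0 := by norm_num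
  -- The pair is rotated by the 3-4-5 angle. In each degenerate case `s` and `t` are multiples of
  -- one `u ≠ 0`, and the rotated pair is `(α u / 5, β u / 5)`.
  have key : ∀ u α β : F, u ≠ 0 → α ≠ 0 → β ≠ 0 → α ^ 2 - β ^ 2 ≠ 0 →
      3 * s - 4 * t = α * u → 4 * s + 3 * t = β * u →
      (3 * s - 4 * t) / 5 ≠ 0 ∧ (4 * s + 3 * t) / 5 ≠ 0 ∧
        ((3 * s - 4 * t) / 5) ^ 2 - ((4 * s + 3 * t) / 5) ^ 2 ≠ 0 := by
    intro u α β hu hα hβ hαβ hs ht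
    rw [hs, ht]
    refine ⟨by positivity, by positivity, ?_⟩
    have : (α * u / 5) ^ 2 - (β * u / 5) ^ 2 = (α ^ 2 - β ^ 2) * u ^ 2 / 25 := by ring
    rw [this]
    exact div_ne_zero (mul_ne_zero hαβ (pow_ne_zero 2 hu)) (by norm_num)
  by_cases hg : s ≠ 0 ∧ t ≠ 0 ∧ s ^ 2 - t ^ 2 ≠ 0
  · exact ⟨s, t, h, hg⟩
  refine ⟨(3 * s - 4 * t) / 5, (4 * s + 3 * t) / 5, by linear_combination h, ?_⟩
  by_cases hs : s = 0
  · have ht : t ≠ 0 := by rintro rfl; simp [hs] at h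
    exact key t (-4) 3 ht (by norm_num) (by norm_num) (by norm_num) (by rw [hs]; ring)
      (by rw [hs]; ring)
  by_cases ht : t = 0
  · exact key s 3 4 hs (by norm_num) (by norm_num) (by norm_num) (by rw [ht]; ring)
      (by rw [ht]; ring)
  have hst : s ^ 2 - t ^ 2 = 0 := by tauto
  have hst' : (s - t) * (s + t) = 0 := by linear_combination hst
  rcases mul_eq_zero.1 hst' with e | e
  · exact key s (-1) 7 hs (by norm_num) (by norm_num) (by norm_num)
      (by linear_combination 4 * e) (by linear_combination -3 * e)
  · exact key s 7 1 hs (by norm_num) (by norm_num) (by norm_num)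
      (by linear_combination -4 * e) (by linear_combination 3 * e)

theorem kLength_sextic_eq_four_iff (K : Subfield ℂ) :
    kLength K 6 sextic = 4 ↔ ∃ s t : K, s ^ 2 + t ^ 2 = -1 := by
  refine (kLength_eq_succ_iff 3).trans ⟨fun h => exists_sq_add_sq_of_rep_four h.1, ?_⟩
  rintro ⟨s, t, h⟩
  obtain ⟨s, t, h, hs, ht, hst⟩ := exists_generic_sq_add_sq h
  exact ⟨hasPowerSumRep_four h hs ht hst, not_hasPowerSumRep_three K⟩

/-! ### Legendre's theorem and a weak three squares theorem -/

theorem not_isSquare_prime_mul {q k : ℕ} (hq : q.Prime) (hk : ¬ q ∣ k) : ¬ IsSquare (q * k) := by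
  rintro ⟨a, ha⟩
  obtain ⟨b, rfl⟩ : q ∣ a := by
    have : q ∣ a * a := ⟨k, ha.symm⟩
    simpa using hq.dvd_mul.1 this
  exact hk ⟨b * b, Nat.eq_of_mul_eq_mul_left hq.pos (by rw [ha]; ring)⟩

/-- By the Chinese remainder theorem `hdvd` encodes `x ≡ s y` mod `m` and `x ≡ r z` mod `Q`, so `x^2
+ Q y^2 - m z^2` is a multiple of `m Q`. The size bounds leave only the values 0 and `m Q`. -/
theorem exists_ternary_zero_of_small {m Q : ℕ} (hm : 0 < m) (hQ : 0 < Q) {u v r s x y z : ℤ}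
    (huv : u * m + v * Q = 1) (hr : (Q : ℤ) ∣ r ^ 2 - m) (hs : (m : ℤ) ∣ Q + s ^ 2)
    (hdvd : (m : ℤ) * Q ∣ x - s * v * Q * y - r * u * m * z)
    (hxyz : ¬ (x = 0 ∧ y = 0 ∧ z = 0)) (hxA : x ^ 2 < (m : ℤ) * Q) (hyB : y ^ 2 ≤ (m : ℤ))
    (hzD : z ^ 2 < (Q : ℤ)) : ∃ x y z : ℤ, x ^ 2 + Q * y ^ 2 = m * z ^ 2 ∧ z ≠ 0 := by
  have hm' : (0 : ℤ) < m := by exact_mod_cast hm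
  have hQ' : (0 : ℤ) < Q := by exact_mod_cast hQ
  obtain ⟨k, hk⟩ := hdvd
  obtain ⟨r', hr⟩ := hr
  obtain ⟨s', hs⟩ := hs
  have hdm : (m : ℤ) ∣ x ^ 2 + Q * y ^ 2 - m * z ^ 2 := by
    have : x - s * y = m * (Q * k + r * u * z - s * u * y) := by
      linear_combination hk + s * y * huv
    exact ⟨(Q * k + r * u * z - s * u * y) * (x + s * y) + s' * y ^ 2 - z ^ 2, by
      linear_combination (x + s * y) * this + y ^ 2 * hs⟩
  have hdQ : (Q : ℤ) ∣ x ^ 2 + Q * y ^ 2 - m * z ^ 2 := by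
    have : x - r * z = Q * (m * k + s * v * y - r * v * z) := by
      linear_combination hk + r * z * huv
    exact ⟨(m * k + s * v * y - r * v * z) * (x + r * z) + r' * z ^ 2 + y ^ 2, by
      linear_combination (x + r * z) * this + z ^ 2 * hr⟩
  obtain ⟨t, ht⟩ := (show IsCoprime (m : ℤ) Q from ⟨u, v, huv⟩).mul_dvd hdm hdQ
  have hM : (0 : ℤ) < m * Q := mul_pos hm' hQ'
  have h1 : (m : ℤ) * z ^ 2 < m * Q := mul_lt_mul_of_pos_left hzD hm'
  have h2 : (Q : ℤ) * y ^ 2 ≤ Q * m := mul_le_mul_of_nonneg_left hyB hQ'.le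
  have ht1 : t < 2 := by
    by_contra! h
    linarith [mul_le_mul_of_nonneg_left h hM.le, mul_nonneg hm'.le (sq_nonneg z)]
  have ht0 : -1 < t := by
    by_contra! h
    linarith [mul_le_mul_of_nonneg_left h hM.le, sq_nonneg x, mul_nonneg hQ'.le (sq_nonneg y)]
  obtain rfl | rfl : t = 0 ∨ t = 1 := by omega
  · refine ⟨x, y, z, by linear_combination ht, ?_⟩
    rintro rfl
    apply hxyz
    have hx0 : x ^ 2 = 0 := by linarith [sq_nonneg x, mul_nonneg hQ'.le (sq_nonneg y)]
    have hy0 : (Q : ℤ) * y ^ 2 = 0 := by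
      linarith [sq_nonneg x, mul_nonneg hQ'.le (sq_nonneg y)]
    exact ⟨pow_eq_zero_iff two_ne_zero |>.1 hx0,
      pow_eq_zero_iff two_ne_zero |>.1 ((mul_eq_zero.1 hy0).resolve_left hQ'.ne'), rfl⟩
  -- Here `x^2 + Q y^2 = m (z^2 + Q)`; multiplying by the norm `z^2 + Q` and composing the two norms
  -- turns the right side into `m (z^2 + Q)^2`.
  · exact ⟨x * z + Q * y, y * z - x, z ^ 2 + Q, by linear_combination (z ^ 2 + Q) * ht,
      by positivity⟩

/-- A case of Legendre's theorem on ternary quadratic forms, by the pigeonhole principle. -/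
theorem exists_ternary_zero {m Q : ℕ} (hm : 0 < m) (hQ : 0 < Q) (hco : m.Coprime Q)
    (hmQ : ¬ IsSquare (m * Q)) (hQs : ¬ IsSquare Q) {r s : ℤ} (hr : (Q : ℤ) ∣ r ^ 2 - m)
    (hs : (m : ℤ) ∣ Q + s ^ 2) : ∃ x y z : ℤ, x ^ 2 + Q * y ^ 2 = m * z ^ 2 ∧ z ≠ 0 := by
  obtain ⟨u, v, huv⟩ : IsCoprime (m : ℤ) Q := Nat.isCoprime_iff_coprime.2 hco
  obtain ⟨A, hA⟩ : ∃ A, A = Nat.sqrt (m * Q) := ⟨_, rfl⟩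
  obtain ⟨B, hB⟩ : ∃ B, B = Nat.sqrt m := ⟨_, rfl⟩
  obtain ⟨D, hD⟩ : ∃ D, D = Nat.sqrt Q := ⟨_, rfl⟩
  have hA1 : A * A < m * Q :=
    lt_of_le_of_ne (hA ▸ Nat.sqrt_le _) fun h => hmQ ⟨A, h.symm⟩
  have hB1 : B * B ≤ m := hB ▸ Nat.sqrt_le _
  have hD1 : D * D < Q := lt_of_le_of_ne (hD ▸ Nat.sqrt_le _) fun h => hQs ⟨D, h.symm⟩
  have hA2 : m * Q < (A + 1) * (A + 1) := hA ▸ Nat.lt_succ_sqrt _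
  have hB2 : m < (B + 1) * (B + 1) := hB ▸ Nat.lt_succ_sqrt _
  have hD2 : Q < (D + 1) * (D + 1) := hD ▸ Nat.lt_succ_sqrt _
  have hpos : 0 < m * Q := Nat.mul_pos hm hQ
  have : NeZero (m * Q) := ⟨hpos.ne'⟩
  -- The box with sides about `√(mQ)`, `√m`, `√Q` has more integer points than there are residues
  -- mod `m Q`.
  have hcard : m * Q < (A + 1) * ((B + 1) * (D + 1)) := by
    refine lt_of_mul_self_lt_mul_self₀ (Nat.zero_le _) ?_
    calc m * Q * (m * Q) < (A + 1) * (A + 1) * (m * Q) := Nat.mul_lt_mul_of_pos_right hA2 hpos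
      _ ≤ (A + 1) * (A + 1) * (((B + 1) * (B + 1)) * ((D + 1) * (D + 1))) :=
          Nat.mul_le_mul_left _ (Nat.mul_le_mul hB2.le hD2.le)
      _ = _ := by ring
  obtain ⟨p, hp, p', hp', hne, heq⟩ := Finset.exists_ne_map_eq_of_card_lt_of_maps_to
    (s := Finset.range (A + 1) ×ˢ (Finset.range (B + 1) ×ˢ Finset.range (D + 1)))
    (t := (Finset.univ : Finset (ZMod (m * Q))))
    (f := fun p => (((p.1 : ℤ) - s * v * Q * (p.2.1 : ℤ) - r * u * m * (p.2.2 : ℤ) : ℤ) :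
      ZMod (m * Q))) (by simpa [ZMod.card] using hcard) (fun _ _ => Finset.mem_coe.2 (Finset.mem_univ _))
  obtain ⟨x₁, y₁, z₁⟩ := p
  obtain ⟨x₂, y₂, z₂⟩ := p'
  simp only [Finset.mem_product, Finset.mem_range] at hp hp'
  rw [ZMod.intCast_eq_intCast_iff_dvd_sub] at heq
  obtain ⟨x, hx⟩ : ∃ x : ℤ, x = x₂ - x₁ := ⟨_, rfl⟩
  obtain ⟨y, hy⟩ : ∃ y : ℤ, y = y₂ - y₁ := ⟨_, rfl⟩
  obtain ⟨z, hz⟩ : ∃ z : ℤ, z = z₂ - z₁ := ⟨_, rfl⟩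
  have hxyz : ¬ (x = 0 ∧ y = 0 ∧ z = 0) := by
    rintro ⟨h1, h2, h3⟩
    apply hne
    simp only [Prod.mk.injEq]
    omega
  have hdvd : ((m : ℤ) * Q) ∣ x - s * v * Q * y - r * u * m * z := by
    have e : x - s * v * Q * y - r * u * m * z = x₂ - s * v * Q * y₂ - r * u * m * z₂ -
        (x₁ - s * v * Q * y₁ - r * u * m * z₁) := by rw [hx, hy, hz]; ring
    rw [e]
    simpa using heq
  have hxA : x ^ 2 < m * Q := by
    have : x ^ 2 ≤ (A : ℤ) ^ 2 := sq_le_sq' (by omega) (by omega)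
    have h' : (A : ℤ) * A < m * Q := by exact_mod_cast hA1
    linarith [sq (A : ℤ)]
  have hyB : y ^ 2 ≤ m := by
    have : y ^ 2 ≤ (B : ℤ) ^ 2 := sq_le_sq' (by omega) (by omega)
    have h' : (B : ℤ) * B ≤ m := by exact_mod_cast hB1
    linarith [sq (B : ℤ)]
  have hzD : z ^ 2 < Q := by
    have : z ^ 2 ≤ (D : ℤ) ^ 2 := sq_le_sq' (by omega) (by omega)
    have h' : (D : ℤ) * D < Q := by exact_mod_cast hD1
    linarith [sq (D : ℤ)]
  exact exists_ternary_zero_of_small hm hQ huv hr hs hdvd hxyz hxA hyB hzD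

theorem exists_prime_modEq {M e e' : ℕ} (hM : M % 2 = 1) (he : e.Coprime M) (he' : e' % 2 = 1)
    (n : ℕ) : ∃ q > n, q.Prime ∧ q ≡ e [MOD M] ∧ q ≡ e' [MOD 8] := by
  have hc : M.Coprime 8 := by
    have : M.Coprime (2 ^ 3) := Nat.Coprime.pow_right 3 (Nat.coprime_two_right.2
      (Nat.odd_iff.2 hM))
    simpa using this
  have hc' : e'.Coprime 8 := by
    have : e'.Coprime (2 ^ 3) := Nat.Coprime.pow_right 3 (Nat.coprime_two_right.2
      (Nat.odd_iff.2 he'))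
    simpa using this
  obtain ⟨k, hk1, hk2⟩ := Nat.chineseRemainder hc e e'
  have hk : k.Coprime (M * 8) := Nat.Coprime.mul_right
    (by rw [Nat.coprime_iff_gcd_eq_one, hk1.gcd_eq]; exact he)
    (by rw [Nat.coprime_iff_gcd_eq_one, hk2.gcd_eq]; exact hc')
  obtain ⟨q, hqn, hq, hqk⟩ := Nat.forall_exists_prime_gt_and_modEq n (q := M * 8) (by omega) hk
  exact ⟨q, hqn, hq, (hqk.of_mul_right 8).trans hk1, (hqk.of_mul_left M).trans hk2⟩

theorem int_dvd_sq_sub_of_jacobiSym {q : ℕ} (hq : q.Prime) {a : ℤ} (h : jacobiSym a q = 1) :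
    ∃ r : ℤ, (q : ℤ) ∣ r ^ 2 - a := by
  have : Fact q.Prime := ⟨hq⟩
  obtain ⟨r, hr⟩ := ZMod.isSquare_of_jacobiSym_eq_one h
  obtain ⟨r, rfl⟩ := ZMod.intCast_surjective r
  refine ⟨r, ?_⟩
  rw [← ZMod.intCast_zmod_eq_zero_iff_dvd]
  push_cast
  rw [hr]
  ring

/-- A weak form of the three squares theorem: the value of the squarefree `m` is scaled by a
square. -/
theorem exists_mul_sq_eq_three_sq {m : ℕ} (hm : 0 < m) (hsq : Squarefree m)
    (h7 : ¬ m ≡ 7 [MOD 8]) :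
    ∃ x y v z : ℤ, (m : ℤ) * z ^ 2 = x ^ 2 + y ^ 2 + v ^ 2 ∧ z ≠ 0 := by
  -- `Q` is a sum of two squares, so a zero of `x^2 + Q y^2 = m z^2` gives three squares. The last
  -- two conditions supply Legendre's local conditions, with `s = 1`.
  suffices H : ∃ q, q.Prime ∧ q % 4 = 1 ∧ m < q ∧ ∃ Q, (Q = q ∨ Q = 2 * q ∧ m % 2 = 1) ∧
      m ∣ Q + 1 ∧ jacobiSym m q = 1 by
    obtain ⟨q, hq, hq4, hmq, Q, hQ, hmQ, hJ⟩ := H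
    have : Fact q.Prime := ⟨hq⟩
    obtain ⟨a, b, hab⟩ := Nat.Prime.sq_add_sq (p := q) (by omega)
    have hqm : ¬ q ∣ m := fun h => absurd (Nat.le_of_dvd hm h) (by omega)
    have hq2 : ¬ q ∣ 2 := fun h => absurd (Nat.le_of_dvd two_pos h) (by have := hq.two_le; omega)
    obtain ⟨r, hr⟩ := int_dvd_sq_sub_of_jacobiSym hq hJ
    obtain ⟨hQ0, hco, hns1, hns2, ⟨r, hr⟩, c, d, hcd⟩ : 0 < Q ∧ m.Coprime Q ∧
        ¬ IsSquare (m * Q) ∧ ¬ IsSquare Q ∧ (∃ r : ℤ, (Q : ℤ) ∣ r ^ 2 - m) ∧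
        ∃ c d : ℤ, (Q : ℤ) = c ^ 2 + d ^ 2 := by
      have hmco : m.Coprime q := ((Nat.Prime.coprime_iff_not_dvd hq).2 hqm).symm
      rcases hQ with rfl | ⟨rfl, hodd⟩
      · refine ⟨hq.pos, hmco, ?_, ?_, ⟨r, hr⟩, a, b, by exact_mod_cast hab.symm⟩
        · rw [mul_comm]
          exact not_isSquare_prime_mul hq hqm
        · have := not_isSquare_prime_mul hq hq.not_dvd_one
          rwa [mul_one] at this
      · refine ⟨by have := hq.pos; omega,
          Nat.Coprime.mul_right (Nat.coprime_two_right.2 (Nat.odd_iff.2 hodd)) hmco, ?_, ?_,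
          ?_, a + b, a - b, ?_⟩
        · rw [show m * (2 * q) = q * (2 * m) by ring]
          exact not_isSquare_prime_mul hq fun h => ((hq.dvd_mul).1 h).elim hq2 hqm
        · rw [mul_comm]
          exact not_isSquare_prime_mul hq hq2
        -- Adding the odd number `q` changes the parity of `r`, and an odd root of `m` mod `q` is a
        -- root mod `2 q` because `m` is odd.
        · obtain ⟨r', hr', hodd'⟩ : ∃ r' : ℤ, (q : ℤ) ∣ r' ^ 2 - m ∧ r' % 2 = 1 := by
            rcases Int.emod_two_eq_zero_or_one r with h | h
            · refine ⟨r + q, ?_, by omega⟩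
              rw [show (r + q) ^ 2 - (m : ℤ) = (r ^ 2 - m) + q * (2 * r + q) by ring]
              exact dvd_add hr (dvd_mul_right _ _)
            · exact ⟨r, hr, h⟩
          refine ⟨r', ?_⟩
          push_cast
          refine IsCoprime.mul_dvd ?_ ?_ hr'
          · exact_mod_cast Nat.isCoprime_iff_coprime.2
              ((Nat.coprime_two_left (n := q)).2 (Nat.odd_iff.2 (by omega)))
          · have e : (r' * r') % 2 = 1 := by rw [Int.mul_emod, hodd']; rfl
            rw [sq]
            omega
        · rw [← hab]
          push_cast
          ring
    obtain ⟨x, y, z, h, hz⟩ := exists_ternary_zero hm hQ0 hco hns1 hns2 hr (s := 1)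
      (by exact_mod_cast hmQ)
    exact ⟨x, c * y, d * y, z, by rw [← h, hcd]; ring, hz⟩
  have hm4 : m % 4 ≠ 0 := fun h => by
    have := hsq 2 (by omega)
    simp at this
  have hm7 : m % 8 ≠ 7 := h7
  have hcop : ∀ M : ℕ, M % 2 = 1 → (M - 1).Coprime M := fun M hM => by
    have := Nat.coprime_self_sub_left (m := 1) (n := M) (by omega)
    rw [this]
    exact Nat.coprime_one_left M
  have hdvd : ∀ M q : ℕ, M % 2 = 1 → q ≡ M - 1 [MOD M] → M ∣ q + 1 := fun M q hM h => by
    have := h.add_right 1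
    rw [Nat.sub_add_cancel (by omega)] at this
    exact (Nat.modEq_zero_iff_dvd).1 (this.trans (by simp [Nat.ModEq]))
  have hJac : ∀ M q : ℕ, M ∣ q + 1 → jacobiSym q M = jacobiSym (-1) M := fun M q h => by
    apply jacobiSym.mod_left'
    apply Int.emod_eq_emod_iff_emod_sub_eq_zero.2
    apply Int.emod_eq_zero_of_dvd
    rw [sub_neg_eq_add]
    exact_mod_cast h
  rcases Nat.even_or_odd' m with ⟨M, rfl | rfl⟩
  · have hM : M % 2 = 1 := by omega
    -- For `q ≡ -1` mod `M`, reciprocity gives `(m | q) = (2 | q)(-1 | M)`, so `q` mod 8 is chosen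
    -- as 1 or 5 according to `M` mod 4.
    obtain ⟨e', he', hχ⟩ : ∃ e', e' % 4 = 1 ∧ ∀ q, q % 8 = e' % 8 →
        jacobiSym 2 q * jacobiSym (-1) M = 1 := by
      rcases (show M % 4 = 1 ∨ M % 4 = 3 by omega) with h | h
      · refine ⟨1, rfl, fun q hq => ?_⟩
        rw [jacobiSym.at_two (Nat.odd_iff.2 (by omega)), ZMod.χ₈_nat_mod_eight, hq,
          jacobiSym.at_neg_one (Nat.odd_iff.2 hM), ZMod.χ₄_nat_one_mod_four h]
        rfl
      · refine ⟨5, rfl, fun q hq => ?_⟩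
        rw [jacobiSym.at_two (Nat.odd_iff.2 (by omega)), ZMod.χ₈_nat_mod_eight, hq,
          jacobiSym.at_neg_one (Nat.odd_iff.2 hM), ZMod.χ₄_nat_three_mod_four h]
        rfl
    obtain ⟨q, hqn, hq, hqe, hqe'⟩ := exists_prime_modEq hM (hcop M hM) (e' := e') (by omega)
      (2 * M)
    have hq8 : q % 8 = e' % 8 := hqe'
    have hMq := hdvd M q hM hqe
    refine ⟨q, hq, by omega, hqn, q, Or.inl rfl, ?_, ?_⟩
    · exact Nat.Coprime.mul_dvd_of_dvd_of_dvd (Nat.coprime_two_left.2 (Nat.odd_iff.2 hM))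
        (by omega) hMq
    · push_cast
      rw [jacobiSym.mul_left, jacobiSym.quadratic_reciprocity_one_mod_four' (Nat.odd_iff.2 hM)
        (by omega), hJac M q hMq, hχ q hq8]
  · have hm2 : (2 * M + 1) % 2 = 1 := by omega
    rcases Nat.even_or_odd M with h | h
    · have hM4 : (2 * M + 1) % 4 = 1 := by have := Nat.even_iff.1 h; omega
      obtain ⟨q, hqn, hq, hqe, hqe'⟩ := exists_prime_modEq hm2 (hcop _ hm2) (e' := 1) rfl
        (2 * M + 1)
      have hq8 : q % 8 = 1 := hqe'
      have hMq := hdvd _ q hm2 hqe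
      refine ⟨q, hq, by omega, hqn, q, Or.inl rfl, hMq, ?_⟩
      rw [jacobiSym.quadratic_reciprocity_one_mod_four' (Nat.odd_iff.2 hm2)
        (by omega), hJac _ q hMq, jacobiSym.at_neg_one (Nat.odd_iff.2 hm2),
        ZMod.χ₄_nat_one_mod_four hM4]
    · have hM8 : (2 * M + 1) % 8 = 3 := by have := Nat.odd_iff.1 h; omega
      -- `Q = q` fails since `(-1 | m) = -1`. With `q ≡ M`, that is `2 q ≡ -1` mod `m`, one gets `(m
      -- | q) = (2 | m)(-1 | m)`, which is 1 for `m ≡ 3` mod 8 but would be -1 for `m ≡ 7`.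
      obtain ⟨q, hqn, hq, hqe, hqe'⟩ := exists_prime_modEq (e := M) hm2 (by simp)
        (e' := 1) rfl (2 * M + 1)
      have hq8 : q % 8 = 1 := hqe'
      have hMq : (2 * M + 1) ∣ 2 * q + 1 := by
        have := (hqe.mul_left 2).add_right 1
        exact (Nat.modEq_zero_iff_dvd).1 (this.trans (by simp [Nat.ModEq]))
      refine ⟨q, hq, by omega, hqn, 2 * q, Or.inr ⟨rfl, hm2⟩, hMq, ?_⟩
      have e := hJac _ _ hMq
      push_cast at e
      rw [jacobiSym.mul_left, jacobiSym.at_two (Nat.odd_iff.2 hm2), ZMod.χ₈_nat_mod_eight, hM8,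
        jacobiSym.at_neg_one (Nat.odd_iff.2 hm2), ZMod.χ₄_nat_three_mod_four (by omega),
        show ZMod.χ₈ (3 : ℕ) = -1 from rfl] at e
      rw [jacobiSym.quadratic_reciprocity_one_mod_four' (Nat.odd_iff.2 hm2) (by omega)]
      linarith

/-! ### Sums of two squares in imaginary quadratic fields -/

theorem sq_sqrt_mul_I (m : ℕ) : (((Real.sqrt m : ℝ) : ℂ) * Complex.I) ^ 2 = -(m : ℂ) := by
  have h : ((Real.sqrt m : ℝ) : ℂ) ^ 2 = m := by
    rw [← Complex.ofReal_pow, Real.sq_sqrt (Nat.cast_nonneg m), Complex.ofReal_natCast]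
  rw [mul_pow, h, Complex.I_sq, mul_neg_one]

theorem exists_sq_eq_neg_imagQuadraticField (m : ℕ) :
    ∃ w : imagQuadraticField m, w ^ 2 = -(m : imagQuadraticField m) := by
  refine ⟨⟨((Real.sqrt m : ℝ) : ℂ) * Complex.I,
    IntermediateField.mem_adjoin_simple_self ℚ _⟩, Subtype.val_injective ?_⟩
  push_cast
  exact sq_sqrt_mul_I m

theorem exists_eq_add_mul_of_mem_imagQuadraticField {m : ℕ} {z : ℂ}
    (hz : z ∈ imagQuadraticField m) :
    ∃ a b : ℚ, z = a + b * (((Real.sqrt m : ℝ) : ℂ) * Complex.I) := by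
  obtain ⟨w, hw⟩ : ∃ w : ℂ, w = ((Real.sqrt m : ℝ) : ℂ) * Complex.I := ⟨_, rfl⟩
  have hw2 : w ^ 2 = -(m : ℂ) := hw ▸ sq_sqrt_mul_I m
  have hint : IsIntegral ℚ w := by
    refine ⟨Polynomial.X ^ 2 + Polynomial.C (m : ℚ),
      Polynomial.monic_X_pow_add_C _ two_ne_zero, ?_⟩
    simp [hw2]
  have hz' : z ∈ (IntermediateField.adjoin ℚ {w}).toSubalgebra := by rw [hw]; exact hz
  rw [IntermediateField.adjoin_simple_toSubalgebra_of_isAlgebraic hint.isAlgebraic] at hz'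
  rw [← hw]
  clear hz
  induction hz' using Algebra.adjoin_induction with
  | mem x hx =>
    rw [Set.mem_singleton_iff] at hx
    exact ⟨0, 1, by simp [hx]⟩
  | algebraMap r => exact ⟨r, 0, by simp⟩
  | add x y _ _ hx hy =>
    obtain ⟨a, b, rfl⟩ := hx
    obtain ⟨c, d, rfl⟩ := hy
    exact ⟨a + c, b + d, by push_cast; ring⟩
  | mul x y _ _ hx hy =>
    obtain ⟨a, b, rfl⟩ := hx
    obtain ⟨c, d, rfl⟩ := hy
    exact ⟨a * c - b * d * m, a * d + b * c, by push_cast; linear_combination b * d * hw2⟩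

/-- If `-m` is a square and a square multiple of `m` is a sum of three integer squares, then `-1`
is a sum of two squares. -/
theorem exists_sq_add_sq_of_three_sq {F : Type*} [Field F] [CharZero F] {m : ℕ} (hm : 0 < m)
    {w : F} (hw : w ^ 2 = -(m : F)) {x y v z : ℤ}
    (h : (m : ℤ) * z ^ 2 = x ^ 2 + y ^ 2 + v ^ 2) (hz : z ≠ 0) :
    ∃ s t : F, s ^ 2 + t ^ 2 = -1 := by
  have hF : (m : F) * z ^ 2 = x ^ 2 + y ^ 2 + v ^ 2 := by exact_mod_cast congrArg (Int.cast (R := F)) h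
  by_cases hn : x ^ 2 + y ^ 2 = 0
  · have hv : v ≠ 0 := by
      rintro rfl
      have : (m : ℤ) * z ^ 2 ≠ 0 := mul_ne_zero (by exact_mod_cast hm.ne') (pow_ne_zero 2 hz)
      apply this
      rw [h, hn]
      rfl
    have hvF : (v : F) ≠ 0 := Int.cast_ne_zero.2 hv
    have hnF : (x : F) ^ 2 + y ^ 2 = 0 := by exact_mod_cast congrArg (Int.cast (R := F)) hn
    refine ⟨w * z / v, 0, ?_⟩
    field_simp
    linear_combination z ^ 2 * hw - hF - hnF
  · have hnF : (x : F) ^ 2 + y ^ 2 ≠ 0 := by exact_mod_cast hn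
    -- Since `(w z)^2 + v^2 = -(x^2 + y^2)`, dividing by `x^2 + y^2` with the two-square identity
    -- gives `-1`.
    refine ⟨(w * z * x + v * y) / (x ^ 2 + y ^ 2), (w * z * y - v * x) / (x ^ 2 + y ^ 2), ?_⟩
    field_simp
    linear_combination (x ^ 2 + y ^ 2) * z ^ 2 * hw - (x ^ 2 + y ^ 2) * hF

theorem seven_mul_sq_ne_three_sq (n : ℕ) (hn : n ≠ 0) (x y z : ℤ) :
    7 * (n : ℤ) ^ 2 ≠ x ^ 2 + y ^ 2 + z ^ 2 := by
  induction n using Nat.strong_induction_on generalizing x y z with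
  | _ n ih =>
    intro h
    have hsq : ∀ a : ℤ, a % 2 = 0 ∧ a ^ 2 % 4 = 0 ∨ a % 2 = 1 ∧ a ^ 2 % 8 = 1 := fun a => by
      rcases Int.even_or_odd a with ha | ha
      · left
        obtain ⟨b, rfl⟩ := ha
        exact ⟨by omega, by ring_nf; omega⟩
      · have ha := Int.odd_iff.1 ha
        refine Or.inr ⟨ha, ?_⟩
        rcases (show a % 8 = 1 ∨ a % 8 = 3 ∨ a % 8 = 5 ∨ a % 8 = 7 by omega) with h | h | h | h <;>
          simp [sq, Int.mul_emod, h]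
    have hn2 := hsq n
    have hx2 := hsq x
    have hy2 := hsq y
    have hz2 := hsq z
    -- Odd `n` would make 7 a sum of three squares mod 8; for even `n` the sum is 0 mod 4, so `x`,
    -- `y`, `z` are even and the equation descends.
    obtain ⟨k, hk⟩ : ∃ k, n = 2 * k := ⟨n / 2, by omega⟩
    obtain ⟨x, rfl⟩ : ∃ k, x = 2 * k := ⟨x / 2, by omega⟩
    obtain ⟨y, rfl⟩ : ∃ k, y = 2 * k := ⟨y / 2, by omega⟩
    obtain ⟨z, rfl⟩ : ∃ k, z = 2 * k := ⟨z / 2, by omega⟩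
    refine ih k (by omega) (by omega) x y z ?_
    rw [hk] at h
    push_cast at h
    linarith

theorem seven_ne_three_sq (x y z : ℚ) : (7 : ℚ) ≠ x ^ 2 + y ^ 2 + z ^ 2 := by
  intro h
  have hd : ∀ q : ℚ, (q.den : ℚ) ≠ 0 := fun q => by exact_mod_cast q.den_ne_zero
  apply seven_mul_sq_ne_three_sq (x.den * y.den * z.den)
    (mul_ne_zero (mul_ne_zero x.den_ne_zero y.den_ne_zero) z.den_ne_zero)
    (x.num * y.den * z.den) (y.num * x.den * z.den) (z.num * x.den * y.den)
  have hx : (x.num : ℚ) = x * x.den := (Rat.mul_den_eq_num x).symm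
  have hy : (y.num : ℚ) = y * y.den := (Rat.mul_den_eq_num y).symm
  have hz : (z.num : ℚ) = z * z.den := (Rat.mul_den_eq_num z).symm
  have : 7 * ((x.den * y.den * z.den : ℕ) : ℚ) ^ 2 = (x.num * y.den * z.den) ^ 2 +
      (y.num * x.den * z.den) ^ 2 + (z.num * x.den * y.den) ^ 2 := by
    rw [hx, hy, hz, h]
    push_cast
    ring
  exact_mod_cast this

theorem not_exists_sq_add_sq_imagQuadraticField_seven :
    ¬ ∃ s t : imagQuadraticField 7, s ^ 2 + t ^ 2 = -1 := by
  rintro ⟨⟨s, hs⟩, ⟨t, ht⟩, h⟩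
  have h : s ^ 2 + t ^ 2 = -1 := congrArg Subtype.val h
  obtain ⟨a, b, rfl⟩ := exists_eq_add_mul_of_mem_imagQuadraticField hs
  obtain ⟨c, d, rfl⟩ := exists_eq_add_mul_of_mem_imagQuadraticField ht
  have hw2 := sq_sqrt_mul_I 7
  have hre := congrArg Complex.re h
  have him := congrArg Complex.im h
  have h7 : Real.sqrt 7 ^ 2 = 7 := Real.sq_sqrt (by norm_num)
  have h70 : Real.sqrt 7 ≠ 0 := by positivity
  simp [sq] at hre him
  have e1 : a ^ 2 + c ^ 2 - 7 * (b ^ 2 + d ^ 2) = -1 := by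
    have : (a : ℝ) ^ 2 + c ^ 2 - 7 * (b ^ 2 + d ^ 2) = -1 := by
      linear_combination hre + (b ^ 2 + d ^ 2) * h7
    exact_mod_cast this
  have e2 : a * b + c * d = 0 := by
    have : Real.sqrt 7 * ((a : ℝ) * b + c * d) = 0 := by linear_combination him / 2
    exact_mod_cast (mul_eq_zero.1 this).resolve_left h70
  have hn : b ^ 2 + d ^ 2 ≠ 0 := fun h0 => by nlinarith [sq_nonneg a, sq_nonneg c]
  -- As `a b + c d = 0`, the two-square identity gives `(b c - a d)^2 = (a^2 + c^2) n` with `n = b^2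
  -- + d^2`. Since `a^2 + c^2 = 7 n - 1`, this reads `7 n^2 = (b c - a d)^2 + b^2 + d^2`.
  refine seven_ne_three_sq ((b * c - a * d) / (b ^ 2 + d ^ 2)) (b / (b ^ 2 + d ^ 2))
    (d / (b ^ 2 + d ^ 2)) ?_
  field_simp
  linear_combination -(b ^ 2 + d ^ 2) * e1 + (a * b + c * d) * e2

/-! ### The five-term representation and the conclusion -/

/-- With one node at infinity, apolarity only asks the other four to have `e₁ = 0` and `e₂ = 1`;
`e₃` is free. The listed nodes satisfy this when `w^2 = -7`, and the weights solve the resulting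
linear system. -/
theorem hasPowerSumRep_five {K : Subfield ℂ} {w : K} (hw : w ^ 2 = -7) :
    HasPowerSumRep K 6 sextic 5 := by
  refine rep_of_moments
    (c := ![-2 * w, (w + 9) / 88, (w - 9) / 88, (5 - 3 * w) / 264, -(5 + 3 * w) / 264])
    (a := ![1, (w + 1) / 2, (w - 1) / 2, (3 - w) / 2, -(3 + w) / 2]) (b := ![0, 1, 1, 1, 1])
    fun k hk => ?_
  simp only [Fin.sum_univ_five, Matrix.cons_val]
  interval_cases k <;> simp [sexticMoment] <;> grind

theorem theorem4p2 (f : MvPolynomial (Fin 2) ℂ)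
    (hf : f = 6 * X 0 ^ 5 * X 1 - 20 * X 0 ^ 3 * X 1 ^ 3) :
    (∀ K : Subfield ℂ, kLength K 6 f = 4 ↔ stufe K ≤ 2) ∧
    (∀ m : ℕ, 0 < m → Squarefree m → ¬ m ≡ 7 [MOD 8] →
      kLength (imagQuadraticField m) 6 f = 4) ∧
    kLength (imagQuadraticField 7) 6 f = 5 := by
  obtain rfl : f = sextic := hf
  refine ⟨fun K => (kLength_sextic_eq_four_iff K).trans stufe_le_two_iff.symm,
    fun m hm hsq h7 => (kLength_sextic_eq_four_iff _).2 ?_, (kLength_eq_succ_iff 4).2 ⟨?_, ?_⟩⟩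
  · obtain ⟨w, hw⟩ := exists_sq_eq_neg_imagQuadraticField m
    obtain ⟨x, y, v, z, h, hz⟩ := exists_mul_sq_eq_three_sq hm hsq h7
    exact exists_sq_add_sq_of_three_sq hm hw h hz
  · obtain ⟨w, hw⟩ := exists_sq_eq_neg_imagQuadraticField 7
    exact hasPowerSumRep_five (by simpa using hw)
  · exact fun h => not_exists_sq_add_sq_imagQuadraticField_seven (exists_sq_add_sq_of_rep_four h)
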